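/- Let $\mathcal U\subset\mathbb R^4$ be open and simply connected, with Cartesian coordinates $(x^\mu)_{\mu=1,\dots,4}$; let $\mathcal I$ be an index set with $|\mathcal I|=4$, and $(g_{ab})_{a,b\in\mathcal I}$ a constant symmetric matrix of signature $(-,+,+,+)$. Small Latin indices run over $\mathcal I$, capital ones are multiindices in $\mathcal I$, and repeated indices are summed. For multiindices with $|A|=|B_1|+\dots+|B_\ell|=k$ put $${\mathbf A_A}^{B_1\cdots B_\ell}=\tfrac{1}{|B_1|!\cdots|B_\ell|!}\sum_{\pi\in S_k}\operatorname{sgn}(\pi)\,{\delta_{a_{\pi(1)}}}^{b_1}\cdots{\delta_{a_{\pi(k)}}}^{b_k},$$ where $(b_1,\dots,b_k)$ is the concatenation of $B_1,\dots,B_\ell$. Let $S^k$ be the space of all $({X_A}^\mu,{Y_{Am}}^n)$, $|A|=k$, totally antisymmetric in $A$, with ${Y_{Am}}^\ell g_{\ell n}+{Y_{An}}^\ell g_{\ell m}=\frac12{Y_{A\ell}}^\ell g_{mn}$. Let $S^2_{\rm vac}\subset S^2$ be the subspace given by $X=0$, ${\mathbf A_A}^{B}{Y_B}^n=0$ ($|A|=|B|=3$,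 where ${Y_{(b_1b_2b_3)}}^n={Y_{b_1b_2\,b_3}}^n$), ${Y_{Am}}^\ell g_{\ell n}+{Y_{An}}^\ell g_{\ell m}=0$ and ${Y_{anm}}^n=0$. For a smooth map $\blacklozenge=((E,\Gamma),(0,W)):\mathcal U\to S^1\times S^2_{\rm vac}$ let $\mathcal D_\blacklozenge\blacklozenge=((T,U),(0,V))$, where, for $|A|=2$, $|C|=3$, $${T_A}^\mu=-{\mathbf A_A}^{bc}\big({E_b}^\nu\tfrac{\partial}{\partial x^\nu}{E_c}^\mu-{\Gamma_{bc}}^\ell{E_\ell}^\mu\big),$$ $${U_{Am}}^n={W_{Am}}^n-{\mathbf A_A}^{bc}\big({E_b}^\mu\tfrac{\partial}{\partial x^\mu}{\Gamma_{cm}}^n+{\Gamma_{cm}}^\ell{\Gamma_{b\ell}}^n-{\Gamma_{bc}}^\ell{\Gamma_{\ell m}}^n\big),$$ $${V_{Cm}}^n={\mathbf A_C}^{bA}\big({E_b}^\mu\tfrac{\partial}{\partial x^\mu}{W_{Am}}^n+{\Gamma_{b\ell}}^n{W_{Am}}^\ell-{\Gamma_{bm}}^\ell{W_{A\ell}}^n-2{\Gamma_A}^\ell{W_{\ell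 bm}}^n\big).$$ **Proposition.** Let $(E_a)_{a\in\mathcal I}$ be smooth vector fields on $\mathcal U$ which form a basis of the tangent space at each point, and suppose that the Lorentzian metric $g$ on $\mathcal U$ given by $g(E_a,E_b)=g_{ab}$ is Ricci-flat. Then there is a smooth map $\blacklozenge=((E,\Gamma),(0,W)):\mathcal U\to S^1\times S^2_{\rm vac}$, whose component $E$ is the given frame, $E_a={E_a}^\mu\frac{\partial}{\partial x^\mu}$, such that $\mathcal D_\blacklozenge\blacklozenge=0$ and such that $g$ is the metric associated with $\blacklozenge$, that is: 1. the 1-form $\nu$ given by $\nu(E_a)=-\frac12{\Gamma_{an}}^n$ is exact, $\nu=-\mathrm df$ for some $f\in C^\infty(\mathcal U)$ with $g(E_a,E_b)=e^f g_{ab}$; 2. the Levi-Civita connection of $g$ is given by $\nabla_{E_a}E_m={\Gamma_{am}}^nE_n$; 3. the Riemann curvature of $g$ is given by $R(E_a,E_b)E_m={W_{abm}}^nE_n$, where $R(X,Y)Z=\nabla_X\nabla_YZ-\nabla_Y\nabla_XZ-\nabla_{[X,Y]}Z$. -/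

import Mathlib

open scoped ContDiff

noncomputable section

namespace VacuumFormalism

/-! ### Index conventions

`I` is the index set of the frame indices (it will have four elements), `Fin 4` is the index set
of the coordinate indices.  A multiindex of length `k` is a map `Fin k → I`. -/

/-- The coordinate space of the Cartesian coordinates `x^μ`; also the model of each tangent
space. (Only its topology and smooth structure are used, never its norm.) -/
abbrev R4 : Type := Fin 4 → ℝ

/-- The coordinate vector `∂/∂x^μ`. -/
def coordVec (μ : Fin 4) : R4 := Pi.single μ 1

/-- The partial derivative `∂φ/∂x^μ` at `x`. -/
def pd (μ : Fin 4) (φ : R4 → ℝ) (x : R4) : ℝ := fderiv ℝ φ x (coordVec μ)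

/-- Signature `(-,+,+,+)`: by Sylvester's law of inertia, a symmetric matrix which in a suitable
basis of `ℝ^I` (the four columns of `P`) becomes `diag(-1,1,1,1)`. -/
def HasLorentzSignature {I : Type*} [Fintype I] (G : Matrix I I ℝ) : Prop :=
  G.IsSymm ∧ ∃ P : Matrix I (Fin 4) ℝ,
    LinearIndependent ℝ P.col ∧ P.transpose * G * P = Matrix.diagonal ![-1, 1, 1, 1]

/-! ### Lorentzian geometry of an open subset of `ℝ⁴` in Cartesian coordinates -/

/-- A field of bilinear forms on the tangent spaces. -/
abbrev MetricField : Type := R4 → LinearMap.BilinForm ℝ R4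

/-- The matrix `g_{μν}` of a field of bilinear forms at `x`. -/
def metricMatrix (g : MetricField) (x : R4) : Matrix (Fin 4) (Fin 4) ℝ :=
  Matrix.of fun μ ν => g x (coordVec μ) (coordVec ν)

/-- The Christoffel symbols
`½ g^{lam σ} (∂_μ g_{σν} + ∂_ν g_{σμ} - ∂_σ g_{μν})`. -/
def christoffel (g : MetricField) (lam μ ν : Fin 4) (x : R4) : ℝ :=
  (1 / 2) * ∑ σ, (metricMatrix g x)⁻¹ lam σ *
    (pd μ (fun y => metricMatrix g y σ ν) x + pd ν (fun y => metricMatrix g y σ μ) x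
      - pd σ (fun y => metricMatrix g y μ ν) x)

/-- The Levi-Civita connection `∇_X Y` of `g`, applied to vector fields. -/
def leviCivita (g : MetricField) (X Y : R4 → R4) (x : R4) : R4 :=
  fderiv ℝ Y x (X x) + fun lam => ∑ μ, ∑ ν, christoffel g lam μ ν x * X x μ * Y x ν

/-- The Riemann curvature `R(X,Y)Z = ∇_X ∇_Y Z - ∇_Y ∇_X Z - ∇_{[X,Y]} Z`, applied to vector
fields. -/
def riemann (g : MetricField) (X Y Z : R4 → R4) (x : R4) : R4 :=
  leviCivita g X (leviCivita g Y Z) x - leviCivita g Y (leviCivita g X Z) x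
    - leviCivita g (VectorField.lieBracket ℝ X Y) Z x

/-- The Ricci curvature: `Ric(Y,Z)` is the trace of `X ↦ R(X,Y)Z`. -/
def ricci (g : MetricField) (Y Z : R4 → R4) (x : R4) : ℝ :=
  ∑ μ, riemann g (fun _ => coordVec μ) Y Z x μ

/-- All components `Ric(∂_μ, ∂_ν)` of the Ricci curvature vanish on `U`. -/
def RicciFlatOn (U : Set R4) (g : MetricField) : Prop :=
  ∀ x ∈ U, ∀ μ ν, ricci g (fun _ => coordVec μ) (fun _ => coordVec ν) x = 0

/-- The vector fields `E_a` form a basis of the tangent space at each point of `U`. -/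
def IsFrameOn {I : Type*} (U : Set R4) (E : I → R4 → R4) : Prop :=
  ∀ x ∈ U, LinearIndependent ℝ (fun a => E a x) ∧
    Submodule.span ℝ (Set.range fun a => E a x) = ⊤

variable {I : Type*} [Fintype I] [DecidableEq I]

/-! ### The component spaces -/

/-- The symbol `𝐀_A^{B₁⋯B_ℓ}`; `B` is the concatenation of the multiindices `B₁, …, B_ℓ`, and
`blocks` is the list of their lengths. -/
def altSymbol (blocks : List ℕ) {k : ℕ} (A B : Fin k → I) : ℝ :=
  (((blocks.map Nat.factorial).prod : ℕ) : ℝ)⁻¹ *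
    ∑ π : Equiv.Perm (Fin k), ((Equiv.Perm.sign π : ℤ) : ℝ) *
      ∏ i, if A (π i) = B i then (1 : ℝ) else 0

/-- Pairs `(X, Y) = (X_A^μ, Y_{Am}^n)` with `A` a multiindex of length `k`, without any
conditions; `X_A^μ = X A μ` and `Y_{Am}^n = Y A m n`. -/
abbrev Comp (I : Type*) (k : ℕ) : Type _ :=
  ((Fin k → I) → Fin 4 → ℝ) × ((Fin k → I) → I → I → ℝ)

/-- The real vector space `S^k`: `X` and `Y` are totally antisymmetric in the multiindex, and
`Y_{Am}^ℓ g_{ℓn} + Y_{An}^ℓ g_{ℓm} = ½ Y_{Aℓ}^ℓ g_{mn}`. -/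
def S (G : Matrix I I ℝ) (k : ℕ) : Submodule ℝ (Comp I k) where
  carrier := {p |
    (∀ (π : Equiv.Perm (Fin k)) (A : Fin k → I) (μ : Fin 4),
      p.1 (A ∘ π) μ = ((Equiv.Perm.sign π : ℤ) : ℝ) * p.1 A μ) ∧
    (∀ (π : Equiv.Perm (Fin k)) (A : Fin k → I) (m n : I),
      p.2 (A ∘ π) m n = ((Equiv.Perm.sign π : ℤ) : ℝ) * p.2 A m n) ∧
    (∀ (A : Fin k → I) (m n : I),
      ∑ l, p.2 A m l * G l n + ∑ l, p.2 A n l * G l m = (1 / 2) * (∑ l, p.2 A l l) * G m n)}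
  add_mem' := by
    rintro p q ⟨h1, h2, h3⟩ ⟨k1, k2, k3⟩
    refine ⟨fun π A μ => ?_, fun π A m n => ?_, fun A m n => ?_⟩
    · simp only [Prod.fst_add, Pi.add_apply, h1 π A μ, k1 π A μ]; ring
    · simp only [Prod.snd_add, Pi.add_apply, h2 π A m n, k2 π A m n]; ring
    · simp only [Prod.snd_add, Pi.add_apply, add_mul, Finset.sum_add_distrib]
      linear_combination h3 A m n + k3 A m n
  zero_mem' := by
    refine ⟨fun π A μ => ?_, fun π A m n => ?_, fun A m n => ?_⟩ <;> simp
  smul_mem' := by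
    rintro c p ⟨h1, h2, h3⟩
    refine ⟨fun π A μ => ?_, fun π A m n => ?_, fun A m n => ?_⟩
    · simp only [Prod.smul_fst, Pi.smul_apply, smul_eq_mul, h1 π A μ]; ring
    · simp only [Prod.smul_snd, Pi.smul_apply, smul_eq_mul, h2 π A m n]; ring
    · simp only [Prod.smul_snd, Pi.smul_apply, smul_eq_mul, mul_assoc, ← Finset.mul_sum]
      linear_combination c * h3 A m n

/-- The vacuum subspace `S^2_vac` of `S^2`: `X = 0`, the total antisymmetrization of `Y` over all
three lower indices vanishes, `Y_{Am}^ℓ g_{ℓn} + Y_{An}^ℓ g_{ℓm} = 0`, and `Y_{anm}^n = 0`. -/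
def S2vac (G : Matrix I I ℝ) : Submodule ℝ (Comp I 2) where
  carrier := {p | p ∈ S G 2 ∧ p.1 = 0 ∧
    (∀ (A : Fin 3 → I) (n : I), ∑ B : Fin 3 → I,
      altSymbol [3] A B * p.2 ![B 0, B 1] (B 2) n = 0) ∧
    (∀ (A : Fin 2 → I) (m n : I), ∑ l, p.2 A m l * G l n + ∑ l, p.2 A n l * G l m = 0) ∧
    (∀ a m : I, ∑ n, p.2 ![a, n] m n = 0)}
  add_mem' := by
    rintro p q ⟨h0, h1, h2, h3, h4⟩ ⟨k0, k1, k2, k3, k4⟩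
    refine ⟨add_mem h0 k0, by simp [h1, k1], fun A n => ?_, fun A m n => ?_, fun a m => ?_⟩
    · simp only [Prod.snd_add, Pi.add_apply, mul_add, Finset.sum_add_distrib]
      rw [h2, k2, add_zero]
    · simp only [Prod.snd_add, Pi.add_apply, add_mul, Finset.sum_add_distrib]
      linear_combination h3 A m n + k3 A m n
    · simp only [Prod.snd_add, Pi.add_apply, Finset.sum_add_distrib]
      rw [h4, k4, add_zero]
  zero_mem' := by
    refine ⟨zero_mem _, rfl, fun A n => ?_, fun A m n => ?_, fun a m => ?_⟩ <;> simp
  smul_mem' := by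
    rintro c p ⟨h0, h1, h2, h3, h4⟩
    refine ⟨Submodule.smul_mem _ c h0, by simp [h1], fun A n => ?_, fun A m n => ?_,
      fun a m => ?_⟩
    · simp only [Prod.smul_snd, Pi.smul_apply, smul_eq_mul, mul_left_comm _ c,
        ← Finset.mul_sum]
      rw [h2, mul_zero]
    · simp only [Prod.smul_snd, Pi.smul_apply, smul_eq_mul, mul_assoc, ← Finset.mul_sum]
      linear_combination c * h3 A m n
    · simp only [Prod.smul_snd, Pi.smul_apply, smul_eq_mul, ← Finset.mul_sum]
      rw [h4, mul_zero]

/-! ### Fields `♦ = ((E,Γ),(0,W))` and the operator `♦ ↦ D_♦ ♦` -/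

/-- A field of components `((E,Γ),(Z,W))`, with `Z = 0` enforced in `IsSmoothVacSection`. -/
abbrev Diamond (I : Type*) : Type _ := R4 → Comp I 1 × Comp I 2

/-- `♦ ∈ C^∞(U, S^1 × S^2_vac)`. -/
def IsSmoothVacSection (U : Set R4) (G : Matrix I I ℝ) (d : Diamond I) : Prop :=
  ContDiffOn ℝ ∞ d U ∧ ∀ x ∈ U, (d x).1 ∈ S G 1 ∧ (d x).2 ∈ S2vac G

/-- The vector field `E_a = E_a^μ ∂/∂x^μ` of `♦ = ((E,Γ),(0,W))`. -/
def Diamond.E (d : Diamond I) (a : I) (x : R4) : R4 := (d x).1.1 ![a]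

/-- The function `Γ_{bm}^n` of `♦ = ((E,Γ),(0,W))`. -/
def Diamond.Gam (d : Diamond I) (b m n : I) (x : R4) : ℝ := (d x).1.2 ![b] m n

/-- The function `W_{Am}^n`, `|A| = 2`, of `♦ = ((E,Γ),(0,W))`. -/
def Diamond.W (d : Diamond I) (A : Fin 2 → I) (m n : I) (x : R4) : ℝ := (d x).2.2 A m n

/-- `E_b^μ ∂φ/∂x^μ` at `x`. -/
def Diamond.dirDeriv (d : Diamond I) (b : I) (φ : R4 → ℝ) (x : R4) : ℝ :=
  ∑ μ, d.E b x μ * pd μ φ x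

/-- `T_A^μ`, `|A| = 2`. -/
def Diamond.T (d : Diamond I) (A : Fin 2 → I) (μ : Fin 4) (x : R4) : ℝ :=
  -∑ b, ∑ c, altSymbol [1, 1] A ![b, c] *
    (d.dirDeriv b (fun y => d.E c y μ) x - ∑ l, d.Gam b c l x * d.E l x μ)

/-- `U_{Am}^n`, `|A| = 2`. -/
def Diamond.U (d : Diamond I) (A : Fin 2 → I) (m n : I) (x : R4) : ℝ :=
  d.W A m n x - ∑ b, ∑ c, altSymbol [1, 1] A ![b, c] *
    (d.dirDeriv b (d.Gam c m n) x + ∑ l, d.Gam c m l x * d.Gam b l n x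
      - ∑ l, d.Gam b c l x * d.Gam l m n x)

/-- `V_{Cm}^n`, `|C| = 3`. -/
def Diamond.V (d : Diamond I) (C : Fin 3 → I) (m n : I) (x : R4) : ℝ :=
  ∑ b, ∑ A : Fin 2 → I, altSymbol [1, 2] C ![b, A 0, A 1] *
    (d.dirDeriv b (d.W A m n) x + ∑ l, d.Gam b l n x * d.W A m l x
      - ∑ l, d.Gam b m l x * d.W A l n x
      - 2 * ∑ l, d.Gam (A 0) (A 1) l x * d.W ![l, b] m n x)

/-- `D_♦ ♦ = ((T,U),(0,V))`. -/
def Diamond.D (d : Diamond I) (x : R4) : Comp I 2 × Comp I 3 :=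
  ((fun A μ => d.T A μ x, fun A m n => d.U A m n x), (0, fun C m n => d.V C m n x))

/-- The metric `g` on `U` arises from the solution `♦ = ((E,Γ),(0,W))` of the vacuum equations:
`♦` is a smooth section of `S^1 × S^2_vac` with `D_♦ ♦ = 0`, the `E_a` are a frame, and there is
a smooth `f` with `-df = ν`, where `ν(E_a) = -½ Γ_{an}^n`, such that `g(E_a,E_b) = e^f g_{ab}`;
the Levi-Civita connection of `g` is given by `Γ`, and its Riemann curvature by `W`. -/
structure ArisesFrom (U : Set R4) (G : Matrix I I ℝ) (d : Diamond I) (g : MetricField) :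
    Prop where
  smooth_vac : IsSmoothVacSection U G d
  vacuum_eq : ∀ x ∈ U, d.D x = 0
  frame : IsFrameOn U d.E
  conformal_factor : ∃ f : R4 → ℝ, ContDiffOn ℝ ∞ f U ∧
    (∀ x ∈ U, ∀ a, -(1 / 2) * ∑ n, d.Gam a n n x = -(fderiv ℝ f x (d.E a x))) ∧
    (∀ x ∈ U, ∀ a b, g x (d.E a x) (d.E b x) = Real.exp (f x) * G a b)
  connection : ∀ x ∈ U, ∀ a m, leviCivita g (d.E a) (d.E m) x = ∑ n, d.Gam a m n x • d.E n x
  curvature : ∀ x ∈ U, ∀ a b m,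
    riemann g (d.E a) (d.E b) (d.E m) x = ∑ n, d.W ![a, b] m n x • d.E n x

end VacuumFormalism

end

/-! The frame values of `g` are exactly the constants `G a b`, so the conformal factor can be taken
trivial, `f = 0`. Take `Γ` and `W` to be the components, in the given frame, of the Levi-Civita
connection and its curvature (`diamondOf`). Every condition on the section is then a classical fact
of Riemannian geometry. `T = 0` says that the connection is torsion-free, `U = 0` is the formula for
curvature in a frame, and `V = 0` is the second Bianchi identity. Membership in `S2vac` combines the
first Bianchi identity, the antisymmetry of a metric curvature operator, and Ricci-flatness.

The trace terms disappear because endomorphisms antisymmetric with respect to `G` are trace-free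
(`trace_eq_zero_of_compatible`). This puts `Γ` in `S G 1` and makes `ν = 0`.

The classical facts are proved for a connection form `C` on an open set. Tensoriality
(`connCurv_eq_curvTensor`) carries them between vector fields, coordinates and the frame. Neither
symmetry nor smoothness of `g` is assumed: on `U` both follow from the smooth dual coframe
(`eq_frameForm`), and the matrix of `g` has an explicit smooth inverse (`metricMatrix_mul`). The
Christoffel symbols are therefore smooth, and the Koszul formula gives metric compatibility. -/

open scoped ContDiff

noncomputable section

namespace VacuumFormalism

/-! ### Connections on an open subset of a vector space -/

section Connection

variable {F : Type*} [NormedAddCommGroup F] [NormedSpace ℝ F]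

/-- The covariant derivative with connection form `C`. -/
def conn (C : F → F →L[ℝ] F →L[ℝ] F) (X Y : F → F) (x : F) : F :=
  fderiv ℝ Y x (X x) + C x (X x) (Y x)

/-- The curvature of `conn C` as an operation on vector fields. -/
def connCurv (C : F → F →L[ℝ] F →L[ℝ] F) (X Y Z : F → F) (x : F) : F :=
  conn C X (conn C Y Z) x - conn C Y (conn C X Z) x - conn C (VectorField.lieBracket ℝ X Y) Z x

/-- The curvature tensor of the connection form `C`. -/
def curvTensor (C : F → F →L[ℝ] F →L[ℝ] F) (x u v w : F) : F :=
  fderiv ℝ C x u v w - fderiv ℝ C x v u w + C x u (C x v w) - C x v (C x u w)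

variable {C : F → F →L[ℝ] F →L[ℝ] F} {U : Set F} {X Y Z V : F → F} {x : F}

theorem conn_congr {Y' : F → F} (hY : Y =ᶠ[nhds x] Y') : conn C X Y x = conn C X Y' x := by
  simp only [conn, hY.fderiv_eq, hY.eq_of_nhds]

theorem conn_sub (hY : DifferentiableAt ℝ Y x) (hZ : DifferentiableAt ℝ Z x) :
    conn C X (fun y => Y y - Z y) x = conn C X Y x - conn C X Z x := by
  simp only [conn, fderiv_fun_sub hY hZ, sub_apply, map_sub]
  abel

theorem conn_sum_smul {ι : Type*} [Fintype ι] {φ : ι → F → ℝ} {e : ι → F → F}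
    (hφ : ∀ i, DifferentiableAt ℝ (φ i) x) (he : ∀ i, DifferentiableAt ℝ (e i) x) :
    conn C X (fun y => ∑ i, φ i y • e i y) x
      = ∑ i, fderiv ℝ (φ i) x (X x) • e i x + ∑ i, φ i x • conn C X (e i) x := by
  have h : fderiv ℝ (fun y => ∑ i, φ i y • e i y) x
      = ∑ i, (φ i x • fderiv ℝ (e i) x + (fderiv ℝ (φ i) x).smulRight (e i x)) := by
    rw [fderiv_fun_sum fun i _ => (hφ i).fun_smul (he i)]
    exact Finset.sum_congr rfl fun i _ => fderiv_fun_smul (hφ i) (he i)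
  simp only [conn, h, sum_apply, add_apply,
    smul_apply, ContinuousLinearMap.smulRight_apply, map_sum, map_smul,
    Finset.sum_add_distrib, smul_add]
  abel

theorem conn_sum_smul_left {ι : Type*} [Fintype ι] {c : ι → ℝ} {e : ι → F → F}
    (hX : X x = ∑ i, c i • e i x) : conn C X Y x = ∑ i, c i • conn C (e i) Y x := by
  simp only [conn, hX, map_sum, map_smul, sum_apply,
    smul_apply, smul_add, Finset.sum_add_distrib]

theorem contDiffOn_conn (hU : IsOpen U) (hC : ContDiffOn ℝ ∞ C U) (hX : ContDiffOn ℝ ∞ X U)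
    (hY : ContDiffOn ℝ ∞ Y U) : ContDiffOn ℝ ∞ (conn C X Y) U :=
  ((hY.fderiv_of_isOpen hU (by simp)).clm_apply hX).add ((hC.clm_apply hX).clm_apply hY)

theorem contDiffOn_lieBracket (hU : IsOpen U) (hX : ContDiffOn ℝ ∞ X U)
    (hY : ContDiffOn ℝ ∞ Y U) : ContDiffOn ℝ ∞ (VectorField.lieBracket ℝ X Y) U := by
  rw [VectorField.lieBracket_eq]
  exact ((hY.fderiv_of_isOpen hU (by simp)).clm_apply hX).sub
    ((hX.fderiv_of_isOpen hU (by simp)).clm_apply hY)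

theorem contDiffOn_connCurv (hU : IsOpen U) (hC : ContDiffOn ℝ ∞ C U) (hX : ContDiffOn ℝ ∞ X U)
    (hY : ContDiffOn ℝ ∞ Y U) (hZ : ContDiffOn ℝ ∞ Z U) :
    ContDiffOn ℝ ∞ (connCurv C X Y Z) U :=
  ((contDiffOn_conn hU hC hX (contDiffOn_conn hU hC hY hZ)).sub
    (contDiffOn_conn hU hC hY (contDiffOn_conn hU hC hX hZ))).sub
    (contDiffOn_conn hU hC (contDiffOn_lieBracket hU hX hY) hZ)

theorem differentiableAt_of_contDiffOn {G : Type*} [NormedAddCommGroup G] [NormedSpace ℝ G]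
    {f : F → G} (hf : ContDiffOn ℝ ∞ f U) (hU : IsOpen U) (hx : x ∈ U) :
    DifferentiableAt ℝ f x :=
  (hf.contDiffAt (hU.mem_nhds hx)).differentiableAt (by simp)

theorem lieBracket_eq_conn_sub_conn (hC : ∀ u v, C x u v = C x v u) :
    VectorField.lieBracket ℝ X Y x = conn C X Y x - conn C Y X x := by
  simp only [VectorField.lieBracket_eq, conn, hC (X x) (Y x)]
  abel

/-- Tensoriality: in the commutator the second derivatives of `Z` cancel by symmetry, and the terms
differentiating `X` or `Y` are absorbed by the bracket term. Only the values of the fields at `x`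
remain, so arguments may be expanded in any basis. -/
theorem connCurv_eq_curvTensor (hU : IsOpen U) (hx : x ∈ U) (hC : ContDiffOn ℝ ∞ C U)
    (hX : ContDiffOn ℝ ∞ X U) (hY : ContDiffOn ℝ ∞ Y U) (hZ : ContDiffOn ℝ ∞ Z U) :
    connCurv C X Y Z x = curvTensor C x (X x) (Y x) (Z x) := by
  have dC := differentiableAt_of_contDiffOn hC hU hx
  have dX := differentiableAt_of_contDiffOn hX hU hx
  have dY := differentiableAt_of_contDiffOn hY hU hx
  have dZ := differentiableAt_of_contDiffOn hZ hU hx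
  have d2 := differentiableAt_of_contDiffOn (hZ.fderiv_of_isOpen (m := ∞) hU (by simp)) hU hx
  have key : ∀ A B : F → F, DifferentiableAt ℝ B x → conn C A (conn C B Z) x
      = fderiv ℝ (fderiv ℝ Z) x (A x) (B x) + fderiv ℝ Z x (fderiv ℝ B x (A x))
        + (fderiv ℝ C x (A x) (B x) (Z x) + C x (fderiv ℝ B x (A x)) (Z x)
          + C x (B x) (fderiv ℝ Z x (A x)))
        + C x (A x) (fderiv ℝ Z x (B x) + C x (B x) (Z x)) := by
    intro A B dB
    have h1 := d2.hasFDerivAt.clm_apply dB.hasFDerivAt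
    have h2 := (dC.hasFDerivAt.clm_apply dB.hasFDerivAt).clm_apply dZ.hasFDerivAt
    have h3 : fderiv ℝ (conn C B Z) x = _ := (h1.add h2).fderiv
    rw [conn, h3]
    simp only [conn, add_apply, ContinuousLinearMap.comp_apply,
      ContinuousLinearMap.flip_apply]
    abel
  have hs := (hZ.contDiffAt (hU.mem_nhds hx)).isSymmSndFDerivAt
    (minSmoothness_of_isRCLikeNormedField.trans_le 
      (WithTop.coe_le_coe.2 (le_top : (2 : ℕ∞) ≤ ⊤))) (X x) (Y x)
  rw [connCurv, key X Y dY, key Y X dX, hs]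
  simp only [conn, curvTensor, VectorField.lieBracket_eq, map_sub, map_add,
    sub_apply]
  abel

theorem curvTensor_antisymm (u v w : F) : curvTensor C x v u w = -curvTensor C x u v w := by
  simp only [curvTensor]; abel

theorem curvTensor_sum_smul_left {ι : Type*} [Fintype ι] (c : ι → ℝ) (e : ι → F) (v w : F) :
    curvTensor C x (∑ i, c i • e i) v w = ∑ i, c i • curvTensor C x (e i) v w := by
  simp only [curvTensor, map_sum, map_smul, sum_apply,
    smul_apply, smul_add, smul_sub, Finset.sum_add_distrib,
    Finset.sum_sub_distrib]

theorem curvTensor_sum_smul_middle {ι : Type*} [Fintype ι] (c : ι → ℝ) (e : ι → F) (u w : F) :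
    curvTensor C x u (∑ i, c i • e i) w = ∑ i, c i • curvTensor C x u (e i) w := by
  simp only [curvTensor, map_sum, map_smul, sum_apply,
    smul_apply, smul_add, smul_sub, Finset.sum_add_distrib,
    Finset.sum_sub_distrib]

theorem curvTensor_sum_smul_right {ι : Type*} [Fintype ι] (c : ι → ℝ) (e : ι → F) (u v : F) :
    curvTensor C x u v (∑ i, c i • e i) = ∑ i, c i • curvTensor C x u v (e i) := by
  simp only [curvTensor, map_sum, map_smul, smul_add, smul_sub, Finset.sum_add_distrib,
    Finset.sum_sub_distrib]

theorem fderiv_symm_of_symm (hU : IsOpen U) (hx : x ∈ U) (hC : ContDiffOn ℝ ∞ C U)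
    (hs : ∀ y ∈ U, ∀ u v, C y u v = C y v u) (t u v : F) :
    fderiv ℝ C x t u v = fderiv ℝ C x t v u := by
  have dC := (differentiableAt_of_contDiffOn hC hU hx).hasFDerivAt
  have key : ∀ u v, fderiv ℝ (fun y => C y u v) x t = fderiv ℝ C x t u v := fun u v => by
    rw [((dC.clm_apply (hasFDerivAt_const u x)).clm_apply (hasFDerivAt_const v x)).fderiv]
    simp
  rw [← key u v, ← key v u]
  refine DFunLike.congr_fun (Filter.EventuallyEq.fderiv_eq ?_) t
  filter_upwards [hU.mem_nhds hx] with y hy using hs y hy u v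

/-- Once `C` and its derivative are symmetric in their vector slots, all terms of the cyclic sum
cancel in pairs. -/
theorem curvTensor_first_bianchi (hU : IsOpen U) (hx : x ∈ U) (hC : ContDiffOn ℝ ∞ C U)
    (hs : ∀ y ∈ U, ∀ u v, C y u v = C y v u) (u v w : F) :
    curvTensor C x u v w + curvTensor C x v w u + curvTensor C x w u v = 0 := by
  have h := fderiv_symm_of_symm hU hx hC hs
  simp only [curvTensor]
  rw [h u v w, h v w u, h w u v, hs x hx v w, hs x hx u w, hs x hx u v]
  abel

/-- The cyclic sum is the Jacobi identity for the operators `∇_X`, `∇_Y`, `∇_Z` acting on `V`. The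
remaining terms `∇_[[Y,Z],X] V` add up to zero by the Jacobi identity for vector fields. Written
with brackets, the identity involves no torsion, so `C` may be any smooth form. -/
theorem connCurv_second_bianchi (hU : IsOpen U) (hx : x ∈ U) (hC : ContDiffOn ℝ ∞ C U)
    (hX : ContDiffOn ℝ ∞ X U) (hY : ContDiffOn ℝ ∞ Y U) (hZ : ContDiffOn ℝ ∞ Z U)
    (hV : ContDiffOn ℝ ∞ V U) :
    (conn C X (connCurv C Y Z V) x - connCurv C Y Z (conn C X V) x
        - connCurv C (VectorField.lieBracket ℝ Y Z) X V x)
      + (conn C Y (connCurv C Z X V) x - connCurv C Z X (conn C Y V) x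
        - connCurv C (VectorField.lieBracket ℝ Z X) Y V x)
      + (conn C Z (connCurv C X Y V) x - connCurv C X Y (conn C Z V) x
        - connCurv C (VectorField.lieBracket ℝ X Y) Z V x) = 0 := by
  have key : ∀ A B D : F → F, ContDiffOn ℝ ∞ A U → ContDiffOn ℝ ∞ B U → ContDiffOn ℝ ∞ D U →
      conn C A (connCurv C B D V) x = conn C A (conn C B (conn C D V)) x
        - conn C A (conn C D (conn C B V)) x
        - conn C A (conn C (VectorField.lieBracket ℝ B D) V) x := by
    intro A B D hA hB hD
    have h1 := differentiableAt_of_contDiffOn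
      (contDiffOn_conn hU hC hB (contDiffOn_conn hU hC hD hV)) hU hx
    have h2 := differentiableAt_of_contDiffOn
      (contDiffOn_conn hU hC hD (contDiffOn_conn hU hC hB hV)) hU hx
    have h3 := differentiableAt_of_contDiffOn
      (contDiffOn_conn hU hC (contDiffOn_lieBracket hU hB hD) hV) hU hx
    rw [← conn_sub h1 h2, ← conn_sub (h1.fun_sub h2) h3]
    rfl
  have jac : VectorField.lieBracket ℝ (VectorField.lieBracket ℝ Y Z) X x
      = -VectorField.lieBracket ℝ (VectorField.lieBracket ℝ Z X) Y x
        - VectorField.lieBracket ℝ (VectorField.lieBracket ℝ X Y) Z x := by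
    have h := VectorField.leibniz_identity_lieBracket (𝕜 := ℝ) (n := ∞)
      (minSmoothness_of_isRCLikeNormedField.trans_le 
      (WithTop.coe_le_coe.2 (le_top : (2 : ℕ∞) ≤ ⊤)))
      (hX.contDiffAt (hU.mem_nhds hx)) (hY.contDiffAt (hU.mem_nhds hx))
      (hZ.contDiffAt (hU.mem_nhds hx))
    have hZX : VectorField.lieBracket ℝ Z X = fun y => -VectorField.lieBracket ℝ X Z y := by
      funext y; rw [VectorField.lieBracket_swap]
    have e : VectorField.lieBracket ℝ (VectorField.lieBracket ℝ Z X) Y x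
        = VectorField.lieBracket ℝ Y (VectorField.lieBracket ℝ X Z) x := by
      rw [hZX]
      simp only [VectorField.lieBracket_eq, fderiv_fun_neg, map_neg,
        neg_apply]
      abel
    have e' : VectorField.lieBracket ℝ (VectorField.lieBracket ℝ Y Z) X x
        = -VectorField.lieBracket ℝ X (VectorField.lieBracket ℝ Y Z) x := by
      rw [VectorField.lieBracket_swap]
    rw [e, e', h]
    abel
  have jac' : conn C (VectorField.lieBracket ℝ (VectorField.lieBracket ℝ Y Z) X) V x
      = -conn C (VectorField.lieBracket ℝ (VectorField.lieBracket ℝ Z X) Y) V x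
        - conn C (VectorField.lieBracket ℝ (VectorField.lieBracket ℝ X Y) Z) V x := by
    simp only [conn, jac, map_sub, map_neg, sub_apply,
      neg_apply]
    abel
  rw [key X Y Z hX hY hZ, key Y Z X hY hZ hX, key Z X Y hZ hX hY]
  simp only [connCurv]
  rw [jac']
  abel

/-- `conn C` is compatible with the symmetric form `h` on `U`. -/
def IsCompatibleOn (C : F → F →L[ℝ] F →L[ℝ] F) (h : F → F →L[ℝ] F →L[ℝ] ℝ) (U : Set F) : Prop :=
  ∀ x ∈ U, ∀ u v w, fderiv ℝ h x u v w = h x (C x u v) w + h x v (C x u w)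

variable {h : F → F →L[ℝ] F →L[ℝ] ℝ}

theorem fderiv_form_apply (hU : IsOpen U) (hx : x ∈ U) (hh : ContDiffOn ℝ ∞ h U)
    (hc : IsCompatibleOn C h U) (hY : ContDiffOn ℝ ∞ Y U) (hZ : ContDiffOn ℝ ∞ Z U) :
    fderiv ℝ (fun y => h y (Y y) (Z y)) x (X x)
      = h x (conn C X Y x) (Z x) + h x (Y x) (conn C X Z x) := by
  have dh := (differentiableAt_of_contDiffOn hh hU hx).hasFDerivAt
  have dY := (differentiableAt_of_contDiffOn hY hU hx).hasFDerivAt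
  have dZ := (differentiableAt_of_contDiffOn hZ hU hx).hasFDerivAt
  rw [((dh.clm_apply dY).clm_apply dZ).fderiv]
  simp only [conn, add_apply, ContinuousLinearMap.comp_apply,
    ContinuousLinearMap.flip_apply, hc x hx, map_add]
  ring

theorem form_conn_antisymm (hU : IsOpen U) (hx : x ∈ U) (hh : ContDiffOn ℝ ∞ h U)
    (hc : IsCompatibleOn C h U) (hY : ContDiffOn ℝ ∞ Y U) (hZ : ContDiffOn ℝ ∞ Z U)
    {k : ℝ} (hk : ∀ y ∈ U, h y (Y y) (Z y) = k) :
    h x (conn C X Y x) (Z x) + h x (Y x) (conn C X Z x) = 0 := by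
  rw [← fderiv_form_apply hU hx hh hc hY hZ]
  have : (fun y => h y (Y y) (Z y)) =ᶠ[nhds x] fun _ => k := by
    filter_upwards [hU.mem_nhds hx] with y hy using hk y hy
  simp [this.fderiv_eq]

/-- Differentiate the constant `h(Z,V)` twice and antisymmetrize in the two directions: the mixed
terms `h(∇_A Z, ∇_B V)` are symmetric in total and drop out. -/
theorem form_connCurv_antisymm (hU : IsOpen U) (hx : x ∈ U) (hC : ContDiffOn ℝ ∞ C U)
    (hh : ContDiffOn ℝ ∞ h U) (hc : IsCompatibleOn C h U)
    (hX : ContDiffOn ℝ ∞ X U) (hY : ContDiffOn ℝ ∞ Y U) (hZ : ContDiffOn ℝ ∞ Z U)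
    (hV : ContDiffOn ℝ ∞ V U) {k : ℝ} (hk : ∀ y ∈ U, h y (Z y) (V y) = k) :
    h x (connCurv C X Y Z x) (V x) + h x (Z x) (connCurv C X Y V x) = 0 := by
  have key : ∀ A B : F → F, ContDiffOn ℝ ∞ B U →
      h x (conn C A (conn C B Z) x) (V x) + h x (conn C B Z x) (conn C A V x)
        + (h x (conn C A Z x) (conn C B V x) + h x (Z x) (conn C A (conn C B V) x)) = 0 := by
    intro A B hB
    have hBZ := contDiffOn_conn hU hC hB hZ
    have hBV := contDiffOn_conn hU hC hB hV
    rw [← fderiv_form_apply hU hx hh hc hBZ hV, ← fderiv_form_apply hU hx hh hc hZ hBV]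
    -- The first-order identity holds near `x`, so the two functions being differentiated along `A`
    -- are negatives of each other.
    have e : (fun y => h y (Z y) (conn C B V y)) =ᶠ[nhds x]
        fun y => -h y (conn C B Z y) (V y) := by
      filter_upwards [hU.mem_nhds hx] with y hy
      linarith [form_conn_antisymm (X := B) hU hy hh hc hZ hV hk]
    rw [e.fderiv_eq, fderiv_fun_neg]
    simp
  have h1 := key X Y hY
  have h2 := key Y X hX
  have h3 := form_conn_antisymm (X := VectorField.lieBracket ℝ X Y) hU hx hh hc hZ hV hk
  simp only [connCurv, map_sub, sub_apply]
  linarith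

end Connection

/-! ### The antisymmetrization symbols -/

section AltSymbol

/-- For each permutation the Kronecker deltas select the single multiindex `B = A ∘ π`. -/
theorem sum_altSymbol_mul {I : Type*} [Fintype I] [DecidableEq I]
    (blocks : List ℕ) {k : ℕ} (A : Fin k → I) (F : (Fin k → I) → ℝ) :
    ∑ B, altSymbol blocks A B * F B = (((blocks.map Nat.factorial).prod : ℕ) : ℝ)⁻¹ *
      ∑ π : Equiv.Perm (Fin k), ((Equiv.Perm.sign π : ℤ) : ℝ) * F (A ∘ π) := by
  simp only [altSymbol, mul_assoc, Finset.sum_mul, ← Finset.mul_sum]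
  rw [Finset.sum_comm]
  congr 1
  refine Finset.sum_congr rfl fun π _ => ?_
  rw [← Finset.mul_sum]
  congr 1
  rw [Finset.sum_eq_single (A ∘ π)]
  · simp
  · intro B _ hB
    obtain ⟨i, hi⟩ := Function.ne_iff.mp hB
    rw [Finset.prod_eq_zero (Finset.mem_univ i), zero_mul]
    exact if_neg fun h => hi h.symm
  · simp

theorem sum_perm_fin_two (f : Equiv.Perm (Fin 2) → ℝ) :
    ∑ π, ((Equiv.Perm.sign π : ℤ) : ℝ) * f π = f 1 - f (Equiv.swap 0 1) := by
  have h : (Finset.univ : Finset (Equiv.Perm (Fin 2))) = {1, Equiv.swap 0 1} := by decide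
  rw [h, Finset.sum_insert (by decide), Finset.sum_singleton, Equiv.Perm.sign_swap (by decide)]
  simp [sub_eq_add_neg]

theorem sum_perm_fin_three (f : Equiv.Perm (Fin 3) → ℝ) :
    ∑ π, ((Equiv.Perm.sign π : ℤ) : ℝ) * f π
      = f 1 + f (Equiv.swap 0 1 * Equiv.swap 1 2) + f (Equiv.swap 1 2 * Equiv.swap 0 1)
        - f (Equiv.swap 0 1) - f (Equiv.swap 1 2) - f (Equiv.swap 0 2) := by
  have h : (Finset.univ : Finset (Equiv.Perm (Fin 3))) =
      {1, Equiv.swap 0 1 * Equiv.swap 1 2, Equiv.swap 1 2 * Equiv.swap 0 1,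
        Equiv.swap 0 1, Equiv.swap 1 2, Equiv.swap 0 2} := by decide
  rw [h, Finset.sum_insert (by decide), Finset.sum_insert (by decide),
    Finset.sum_insert (by decide), Finset.sum_insert (by decide), Finset.sum_insert (by decide),
    Finset.sum_singleton]
  simp only [Equiv.Perm.sign_mul, Equiv.Perm.sign_one,
    Equiv.Perm.sign_swap (show (0 : Fin 3) ≠ 1 by decide),
    Equiv.Perm.sign_swap (show (1 : Fin 3) ≠ 2 by decide),
    Equiv.Perm.sign_swap (show (0 : Fin 3) ≠ 2 by decide)]
  push_cast
  ring

theorem sum_sum_fin_two {I : Type*} [Fintype I] (f : (Fin 2 → I) → ℝ) :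
    ∑ B, f B = ∑ b, ∑ c, f ![b, c] := by
  rw [← Fintype.sum_prod_type']
  exact Fintype.sum_equiv (finTwoArrowEquiv I) _ _ fun B => by
    congr 1; ext i; fin_cases i <;> rfl

theorem sum_sum_fin_three {I : Type*} [Fintype I] (f : (Fin 3 → I) → ℝ) :
    ∑ B, f B = ∑ b, ∑ A : Fin 2 → I, f ![b, A 0, A 1] := by
  rw [← Fintype.sum_prod_type']
  exact (Fintype.sum_equiv (Fin.consEquiv fun _ => I) _ _ fun p => by
    congr 1; ext i; fin_cases i <;> rfl).symm

theorem sum_altSymbol_one_one {I : Type*} [Fintype I] [DecidableEq I]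
    (A : Fin 2 → I) (F : I → I → ℝ) :
    ∑ b, ∑ c, altSymbol [1, 1] A ![b, c] * F b c = F (A 0) (A 1) - F (A 1) (A 0) := by
  have h := sum_altSymbol_mul [1, 1] A fun B => F (B 0) (B 1)
  rw [sum_sum_fin_two, sum_perm_fin_two fun π => F ((A ∘ π) 0) ((A ∘ π) 1)] at h
  simpa using h

/-- The factor is `1/(1!2!)`. It is compensated when `F` is antisymmetric in its last two slots;
otherwise, as for the term of `V` with coefficient 2, it leaves a commutator. -/
theorem sum_altSymbol_one_two {I : Type*} [Fintype I] [DecidableEq I]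
    (C : Fin 3 → I) (F : I → I → I → ℝ) :
    ∑ b, ∑ A : Fin 2 → I, altSymbol [1, 2] C ![b, A 0, A 1] * F b (A 0) (A 1)
      = (1 / 2) * ((F (C 0) (C 1) (C 2) - F (C 0) (C 2) (C 1))
        + (F (C 1) (C 2) (C 0) - F (C 1) (C 0) (C 2))
        + (F (C 2) (C 0) (C 1) - F (C 2) (C 1) (C 0))) := by
  have h := sum_altSymbol_mul [1, 2] C fun B => F (B 0) (B 1) (B 2)
  rw [sum_sum_fin_three,
    sum_perm_fin_three fun π => F ((C ∘ π) 0) ((C ∘ π) 1) ((C ∘ π) 2)] at h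
  have e1 : (Equiv.swap 0 1 : Equiv.Perm (Fin 3)) 2 = 2 := by decide
  have e2 : (Equiv.swap 1 2 : Equiv.Perm (Fin 3)) 0 = 0 := by decide
  have e3 : (Equiv.swap 0 2 : Equiv.Perm (Fin 3)) 1 = 1 := by decide
  simp [e1, e2, e3] at h
  rw [h]
  ring

/-- The even permutations give the cyclic sum, and by antisymmetry the odd ones give it a second
time. -/
theorem sum_altSymbol_three {I : Type*} [Fintype I] [DecidableEq I]
    (C : Fin 3 → I) (F : I → I → I → ℝ)
    (hF : ∀ b c d, F b c d = -F c b d) (hc : ∀ b c d, F b c d + F c d b + F d b c = 0) :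
    ∑ B : Fin 3 → I, altSymbol [3] C B * F (B 0) (B 1) (B 2) = 0 := by
  rw [sum_altSymbol_mul [3] C fun B => F (B 0) (B 1) (B 2),
    sum_perm_fin_three fun π => F ((C ∘ π) 0) ((C ∘ π) 1) ((C ∘ π) 2)]
  refine mul_eq_zero_of_right _ ?_
  have e1 : (Equiv.swap 0 1 : Equiv.Perm (Fin 3)) 2 = 2 := by decide
  have e2 : (Equiv.swap 1 2 : Equiv.Perm (Fin 3)) 0 = 0 := by decide
  have e3 : (Equiv.swap 0 2 : Equiv.Perm (Fin 3)) 1 = 1 := by decide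
  simp [e1, e2, e3]
  linarith [hF (C 0) (C 1) (C 2), hF (C 1) (C 2) (C 0), hF (C 2) (C 0) (C 1),
    hc (C 0) (C 1) (C 2)]

/-- A function on multiindices of length two is totally antisymmetric if it changes sign under
the transposition. -/
theorem antisymm_fin_two {I : Type*} {f : (Fin 2 → I) → ℝ} (hf : ∀ A, f ![A 1, A 0] = -f A)
    (π : Equiv.Perm (Fin 2)) (A : Fin 2 → I) :
    f (A ∘ π) = ((Equiv.Perm.sign π : ℤ) : ℝ) * f A := by
  have h : π = 1 ∨ π = Equiv.swap 0 1 := by revert π; decide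
  rcases h with rfl | rfl
  · simp
  · have e : A ∘ (Equiv.swap 0 1 : Equiv.Perm (Fin 2)) = ![A 1, A 0] := by
      ext i; fin_cases i <;> simp
    rw [e, hf]
    simp

end AltSymbol

/-! ### The Levi-Civita connection -/

section LeviCivita

theorem sum_smul_coordVec (v : R4) : ∑ μ, v μ • coordVec μ = v := by
  ext ν
  simp [coordVec, Pi.single_apply]

theorem coordVec_induction {p : R4 → Prop} (hp : ∀ μ, p (coordVec μ))
    (hadd : ∀ u v, p u → p v → p (u + v)) (hsmul : ∀ (c : ℝ) v, p v → p (c • v)) (v : R4) :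
    p v := by
  rw [← sum_smul_coordVec v]
  refine Finset.sum_induction _ p hadd ?_ fun μ _ => hsmul _ _ (hp μ)
  simpa using hsmul 0 _ (hp 0)

/-- The connection form of the Levi-Civita connection of `g` in Cartesian coordinates. -/
def lcForm (g : MetricField) (x : R4) : R4 →L[ℝ] R4 →L[ℝ] R4 :=
  ∑ lam, ∑ μ, ∑ ν, christoffel g lam μ ν x •
    (ContinuousLinearMap.proj μ : R4 →L[ℝ] ℝ).smulRight
      ((ContinuousLinearMap.proj ν : R4 →L[ℝ] ℝ).smulRight (coordVec lam))

theorem lcForm_apply (g : MetricField) (x u v : R4) (lam : Fin 4) :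
    lcForm g x u v lam = ∑ μ, ∑ ν, christoffel g lam μ ν x * u μ * v ν := by
  simp only [lcForm, sum_apply, smul_apply, ContinuousLinearMap.smulRight_apply,
    ContinuousLinearMap.proj_apply, Finset.sum_apply, Pi.smul_apply, smul_eq_mul, coordVec,
    Pi.single_apply]
  rw [Finset.sum_eq_single lam (fun κ _ hκ => by simp [hκ.symm]) (by simp)]
  simp [mul_assoc]

theorem leviCivita_eq_conn (g : MetricField) : leviCivita g = conn (lcForm g) := by
  funext X Y x
  simp only [leviCivita, conn]
  congr 1
  ext lam
  rw [lcForm_apply]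

theorem riemann_eq_connCurv (g : MetricField) : riemann g = connCurv (lcForm g) := by
  funext X Y Z x
  simp only [riemann, connCurv, leviCivita_eq_conn]

variable {g : MetricField} {h : R4 → R4 →L[ℝ] R4 →L[ℝ] ℝ} {U : Set R4} {x : R4}

/-- The field `g` carries no regularity of its own. That role falls to the smooth field `h`, which
agrees with `g` on the open set `U` and so has the same derivatives there. -/
theorem pd_metricMatrix (hU : IsOpen U) (hx : x ∈ U) (hh : ContDiffOn ℝ ∞ h U)
    (hg : ∀ y ∈ U, ∀ u v, g y u v = h y u v) (κ μ ν : Fin 4) :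
    pd κ (fun y => metricMatrix g y μ ν) x
      = fderiv ℝ h x (coordVec κ) (coordVec μ) (coordVec ν) := by
  have dh := (differentiableAt_of_contDiffOn hh hU hx).hasFDerivAt
  have e : (fun y => metricMatrix g y μ ν) =ᶠ[nhds x] fun y => h y (coordVec μ) (coordVec ν) := by
    filter_upwards [hU.mem_nhds hx] with y hy using hg y hy _ _
  rw [pd, e.fderiv_eq, ((dh.clm_apply (hasFDerivAt_const (coordVec μ) x)).clm_apply
    (hasFDerivAt_const (coordVec ν) x)).fderiv]
  simp

theorem contDiffOn_metricMatrix (hh : ContDiffOn ℝ ∞ h U)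
    (hg : ∀ y ∈ U, ∀ u v, g y u v = h y u v) (μ ν : Fin 4) :
    ContDiffOn ℝ ∞ (fun y => metricMatrix g y μ ν) U :=
  ((hh.clm_apply contDiffOn_const).clm_apply contDiffOn_const).congr fun y hy =>
    hg y hy (coordVec μ) (coordVec ν)

theorem contDiffOn_smul_const {F : Type*} [NormedAddCommGroup F] [NormedSpace ℝ F] {φ : R4 → ℝ}
    (hφ : ContDiffOn ℝ ∞ φ U) (v : F) : ContDiffOn ℝ ∞ (fun y => φ y • v) U :=
  hφ.smul contDiffOn_const

theorem contDiffOn_lcForm (hU : IsOpen U) (hh : ContDiffOn ℝ ∞ h U)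
    (hg : ∀ y ∈ U, ∀ u v, g y u v = h y u v)
    (hi : ∀ μ ν, ContDiffOn ℝ ∞ (fun y => (metricMatrix g y)⁻¹ μ ν) U) :
    ContDiffOn ℝ ∞ (lcForm g) U := by
  have hp : ∀ κ μ ν, ContDiffOn ℝ ∞ (pd κ fun y => metricMatrix g y μ ν) U := fun κ μ ν =>
    ((contDiffOn_metricMatrix hh hg μ ν).fderiv_of_isOpen hU (by simp)).clm_apply contDiffOn_const
  refine ContDiffOn.sum fun lam _ => ContDiffOn.sum fun μ _ => ContDiffOn.sum fun ν _ => ?_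
  refine contDiffOn_smul_const ?_ _
  exact contDiffOn_const.mul (ContDiffOn.sum fun σ _ =>
    (hi lam σ).mul (((hp μ σ ν).add (hp ν σ μ)).sub (hp σ μ ν)))

theorem fderiv_form_symm (hU : IsOpen U) (hx : x ∈ U) (hh : ContDiffOn ℝ ∞ h U)
    (hs : ∀ y ∈ U, ∀ u v, h y u v = h y v u) (t u v : R4) :
    fderiv ℝ h x t u v = fderiv ℝ h x t v u := by
  have dh := (differentiableAt_of_contDiffOn hh hU hx).hasFDerivAt
  have key : ∀ u v, fderiv ℝ (fun y => h y u v) x t = fderiv ℝ h x t u v := fun u v => by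
    rw [((dh.clm_apply (hasFDerivAt_const u x)).clm_apply (hasFDerivAt_const v x)).fderiv]
    simp
  rw [← key u v, ← key v u]
  refine DFunLike.congr_fun (Filter.EventuallyEq.fderiv_eq ?_) t
  filter_upwards [hU.mem_nhds hx] with y hy using hs y hy u v

theorem lcForm_symm (hU : IsOpen U) (hx : x ∈ U) (hh : ContDiffOn ℝ ∞ h U)
    (hg : ∀ y ∈ U, ∀ u v, g y u v = h y u v) (hs : ∀ y ∈ U, ∀ u v, h y u v = h y v u)
    (u v : R4) : lcForm g x u v = lcForm g x v u := by
  ext lam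
  rw [lcForm_apply, lcForm_apply, Finset.sum_comm]
  refine Finset.sum_congr rfl fun μ _ => Finset.sum_congr rfl fun ν _ => ?_
  have : christoffel g lam ν μ x = christoffel g lam μ ν x := by
    simp only [christoffel, pd_metricMatrix hU hx hh hg]
    congr 1
    refine Finset.sum_congr rfl fun σ _ => ?_
    rw [fderiv_form_symm hU hx hh hs (coordVec σ) (coordVec μ) (coordVec ν)]
    ring
  rw [this]
  ring

theorem lcForm_coordVec (μ ν lam : Fin 4) :
    lcForm g x (coordVec μ) (coordVec ν) lam = christoffel g lam μ ν x := by
  rw [lcForm_apply]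
  simp [coordVec, Pi.single_apply]

/-- Lowering the upper index of the Christoffel symbol cancels the inverse metric. Both sides are
trilinear, so coordinate vectors suffice. -/
theorem lcForm_koszul (hU : IsOpen U) (hx : x ∈ U) (hh : ContDiffOn ℝ ∞ h U)
    (hg : ∀ y ∈ U, ∀ u v, g y u v = h y u v) (hs : ∀ y ∈ U, ∀ u v, h y u v = h y v u)
    (hi : metricMatrix g x * (metricMatrix g x)⁻¹ = 1) (u v w : R4) :
    h x (lcForm g x u v) w
      = (1 / 2) * (fderiv ℝ h x u v w + fderiv ℝ h x v u w - fderiv ℝ h x w u v) := by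
  revert u v w
  refine coordVec_induction (fun μ => coordVec_induction (fun ν => coordVec_induction
    (fun κ => ?_) ?_ ?_) ?_ ?_) ?_ ?_
  · have e : h x (lcForm g x (coordVec μ) (coordVec ν)) (coordVec κ)
        = ∑ lam, metricMatrix g x κ lam * christoffel g lam μ ν x := by
      rw [hs x hx]
      conv_lhs => rw [← sum_smul_coordVec (lcForm g x (coordVec μ) (coordVec ν))]
      simp only [map_sum, map_smul, lcForm_coordVec, metricMatrix, Matrix.of_apply, hg x hx,
        smul_eq_mul, mul_comm]
    have e' : ∀ s : Fin 4 → ℝ,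
        ∑ lam, metricMatrix g x κ lam * ((1 / 2) * ∑ σ, (metricMatrix g x)⁻¹ lam σ * s σ)
          = (1 / 2) * s κ := by
      intro s
      have := congrFun (congrArg (fun A => Matrix.mulVec A s) hi) κ
      simp only [← Matrix.mulVec_mulVec, Matrix.one_mulVec] at this
      rw [← this]
      simp only [Matrix.mulVec, dotProduct, Finset.mul_sum]
      refine Finset.sum_congr rfl fun lam _ => Finset.sum_congr rfl fun σ _ => ?_
      ring
    rw [e]
    simp only [christoffel]
    rw [e']
    simp only [pd_metricMatrix hU hx hh hg]
    rw [fderiv_form_symm hU hx hh hs (coordVec μ) (coordVec κ) (coordVec ν),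
      fderiv_form_symm hU hx hh hs (coordVec ν) (coordVec κ) (coordVec μ)]
  all_goals simp only [map_add, add_apply, map_smul, smul_apply, smul_eq_mul]
  · intro u v hu hv; linear_combination hu + hv
  · intro c u hu; linear_combination c * hu
  · intro u v hu hv w; linear_combination hu w + hv w
  · intro c u hu w; linear_combination c * hu w
  · intro u v hu hv w t; linear_combination hu w t + hv w t
  · intro c u hu w t; linear_combination c * hu w t

/-- Adding the Koszul formula to its copy with `v` and `w` exchanged leaves only the derivative
along `u`. -/
theorem isCompatibleOn_lcForm (hU : IsOpen U) (hh : ContDiffOn ℝ ∞ h U)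
    (hg : ∀ y ∈ U, ∀ u v, g y u v = h y u v) (hs : ∀ y ∈ U, ∀ u v, h y u v = h y v u)
    (hi : ∀ y ∈ U, metricMatrix g y * (metricMatrix g y)⁻¹ = 1) :
    IsCompatibleOn (lcForm g) h U := by
  intro x hx u v w
  rw [hs x hx v, lcForm_koszul hU hx hh hg hs (hi x hx), lcForm_koszul hU hx hh hg hs (hi x hx)]
  rw [fderiv_form_symm hU hx hh hs u w v]
  ring

end LeviCivita

/-! ### Frames and their dual coframes -/

section Frame

variable {I : Type*} [Fintype I]

/-- The linear map taking components with respect to the frame `E` to vectors. -/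
def frameMap (E : I → R4 → R4) (x : R4) : (I → ℝ) →L[ℝ] R4 :=
  ∑ a, (ContinuousLinearMap.proj a : (I → ℝ) →L[ℝ] ℝ).smulRight (E a x)

/-- The components of vectors with respect to the frame `E`. -/
def coframe (E : I → R4 → R4) (x : R4) : R4 →L[ℝ] (I → ℝ) :=
  (frameMap E x).inverse

variable {E : I → R4 → R4} {U : Set R4} {x : R4}

theorem frameMap_apply (c : I → ℝ) : frameMap E x c = ∑ a, c a • E a x := by
  simp [frameMap]

theorem IsFrameOn.exists_equiv (hE : IsFrameOn U E) (hx : x ∈ U) :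
    ∃ e : (I → ℝ) ≃L[ℝ] R4, (e : (I → ℝ) →L[ℝ] R4) = frameMap E x := by
  let b := Module.Basis.mk (hE x hx).1 (hE x hx).2.ge
  refine ⟨b.equivFun.symm.toContinuousLinearEquiv, ?_⟩
  ext1 c
  rw [frameMap_apply]
  simp [b, Module.Basis.equivFun_symm_apply]

/-- Inversion of operators is smooth at invertible ones; on `U` the default value of `inverse` never
occurs. -/
theorem contDiffOn_coframe (hE : IsFrameOn U E) (hs : ∀ a, ContDiffOn ℝ ∞ (E a) U) :
    ContDiffOn ℝ ∞ (coframe E) U := by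
  have h : ContDiffOn ℝ ∞ (frameMap E) U :=
    ContDiffOn.sum fun a _ => contDiffOn_const.smulRight (hs a)
  intro x hx
  obtain ⟨e, he⟩ := hE.exists_equiv hx
  have := contDiffAt_map_inverse (n := ∞) e
  rw [he] at this
  exact this.comp_contDiffWithinAt x (h x hx)

theorem sum_coframe_smul (hE : IsFrameOn U E) (hx : x ∈ U) (v : R4) :
    ∑ a, coframe E x v a • E a x = v := by
  obtain ⟨e, he⟩ := hE.exists_equiv hx
  rw [← frameMap_apply, coframe, ← he, ContinuousLinearMap.inverse_equiv]
  simp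

theorem coframe_sum_smul (hE : IsFrameOn U E) (hx : x ∈ U) (c : I → ℝ) :
    coframe E x (∑ a, c a • E a x) = c := by
  obtain ⟨e, he⟩ := hE.exists_equiv hx
  rw [← frameMap_apply, coframe, ← he, ContinuousLinearMap.inverse_equiv]
  simp

theorem coframe_frame [DecidableEq I] (hE : IsFrameOn U E) (hx : x ∈ U) (a : I) :
    coframe E x (E a x) = Pi.single a 1 := by
  rw [← coframe_sum_smul hE hx (Pi.single a 1)]
  simp [Pi.single_apply]

/-- The symmetric form with constant components `G` with respect to the frame `E`. -/
def frameForm (G : Matrix I I ℝ) (E : I → R4 → R4) (x : R4) : R4 →L[ℝ] R4 →L[ℝ] ℝ :=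
  ∑ a, ∑ b, G a b • ((ContinuousLinearMap.proj a : (I → ℝ) →L[ℝ] ℝ).comp
    (coframe E x)).smulRight ((ContinuousLinearMap.proj b : (I → ℝ) →L[ℝ] ℝ).comp (coframe E x))

variable {G : Matrix I I ℝ} {g : MetricField}

theorem frameForm_apply (u v : R4) :
    frameForm G E x u v = ∑ a, ∑ b, G a b * (coframe E x u a * coframe E x v b) := by
  simp [frameForm]

theorem frameForm_symm (hG : G.IsSymm) (u v : R4) : frameForm G E x u v = frameForm G E x v u := by
  rw [frameForm_apply, frameForm_apply, Finset.sum_comm]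
  refine Finset.sum_congr rfl fun a _ => Finset.sum_congr rfl fun b _ => ?_
  rw [hG.apply]
  ring

theorem contDiffOn_frameForm (hE : IsFrameOn U E) (hs : ∀ a, ContDiffOn ℝ ∞ (E a) U) :
    ContDiffOn ℝ ∞ (frameForm G E) U := by
  have hθ := contDiffOn_coframe hE hs
  exact ContDiffOn.sum fun a _ => ContDiffOn.sum fun b _ => ContDiffOn.const_smul (G a b)
    ((contDiffOn_const.clm_comp hθ).smulRight (contDiffOn_const.clm_comp hθ))

theorem eq_frameForm (hE : IsFrameOn U E) (hx : x ∈ U)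
    (hg : ∀ a b, g x (E a x) (E b x) = G a b) (u v : R4) : g x u v = frameForm G E x u v := by
  rw [frameForm_apply]
  conv_lhs => rw [← sum_coframe_smul hE hx u, ← sum_coframe_smul hE hx v]
  simp only [map_sum, map_smul, LinearMap.sum_apply, LinearMap.smul_apply, hg, smul_eq_mul,
    Finset.mul_sum]
  rw [Finset.sum_comm]
  refine Finset.sum_congr rfl fun a _ => Finset.sum_congr rfl fun b _ => ?_
  ring

theorem HasLorentzSignature.exists_inverse [DecidableEq I] (hI : Fintype.card I = 4)
    (hG : HasLorentzSignature G) : ∃ H : Matrix I I ℝ, G * H = 1 := by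
  obtain ⟨-, P, -, hP⟩ := hG
  let D : Matrix (Fin 4) (Fin 4) ℝ := Matrix.diagonal ![-1, 1, 1, 1]
  have hD : D * D = 1 := by
    rw [Matrix.diagonal_mul_diagonal, ← Matrix.diagonal_one]
    congr 1
    ext i
    fin_cases i <;> simp
  have h1 : (D * P.transpose * G) * P = 1 := by
    rw [← hD]
    simp only [D, ← hP, Matrix.mul_assoc]
  -- `P` is square up to reindexing because `I` has four elements, so its left inverse is also a
  -- right inverse. Hence `P * D * Pᵀ` inverts `G`.
  have h2 := (Matrix.mul_eq_one_comm_of_equiv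
    (Fintype.equivFinOfCardEq hI).symm).1 h1
  refine ⟨P * D * P.transpose, (Matrix.mul_eq_one_comm_of_equiv (Equiv.refl I)).1 ?_⟩
  simpa only [Matrix.mul_assoc] using h2

/-- With mutually inverse matrices `T` (coframe) and `F` (frame), the metric is `Tᵀ G T` and its
inverse is `F H Fᵀ`, visibly smooth in the frame. -/
theorem metricMatrix_mul [DecidableEq I] (hE : IsFrameOn U E) (hx : x ∈ U)
    (hg : ∀ a b, g x (E a x) (E b x) = G a b) {H : Matrix I I ℝ} (hH : G * H = 1) :
    metricMatrix g x * Matrix.of (fun μ ν => ∑ a, ∑ b, H a b * (E a x μ * E b x ν)) = 1 := by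
  let T : Matrix I (Fin 4) ℝ := Matrix.of fun a μ => coframe E x (coordVec μ) a
  let F : Matrix (Fin 4) I ℝ := Matrix.of fun μ a => E a x μ
  have hTF : T * F = 1 := by
    ext a b
    have := congrFun (coframe_frame hE hx b) a
    rw [← sum_smul_coordVec (E b x)] at this
    simp only [map_sum, map_smul, Finset.sum_apply, Pi.smul_apply, smul_eq_mul] at this
    rw [Matrix.one_apply, Matrix.mul_apply]
    simp only [T, F, Matrix.of_apply, mul_comm, this, Pi.single_apply]
  have hFT : F * T = 1 := by
    ext μ ν
    have := congrFun (sum_coframe_smul hE hx (coordVec ν)) μ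
    simp only [Finset.sum_apply, Pi.smul_apply, smul_eq_mul] at this
    rw [Matrix.one_apply, Matrix.mul_apply]
    exact (Finset.sum_congr rfl fun a _ => mul_comm _ _).trans
      (this.trans (by simp [coordVec, Pi.single_apply]))
  have h1 : metricMatrix g x = T.transpose * G * T := by
    ext μ ν
    simp only [metricMatrix, Matrix.of_apply, eq_frameForm hE hx hg, frameForm_apply,
      Matrix.mul_apply, Matrix.transpose_apply, T, Finset.sum_mul]
    rw [Finset.sum_comm]
    refine Finset.sum_congr rfl fun a _ => Finset.sum_congr rfl fun b _ => ?_
    ring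
  have h2 : Matrix.of (fun μ ν => ∑ a, ∑ b, H a b * (E a x μ * E b x ν))
      = F * H * F.transpose := by
    ext μ ν
    simp only [Matrix.mul_apply, Matrix.transpose_apply, F, Matrix.of_apply, Finset.sum_mul]
    rw [Finset.sum_comm]
    refine Finset.sum_congr rfl fun a _ => Finset.sum_congr rfl fun b _ => ?_
    ring
  calc _ = T.transpose * (G * ((T * F) * H)) * F.transpose := by
        rw [h1, h2]; simp only [Matrix.mul_assoc]
    _ = (F * T).transpose := by
        rw [hTF, Matrix.one_mul, hH, Matrix.mul_one, Matrix.transpose_mul]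
    _ = 1 := by rw [hFT, Matrix.transpose_one]

end Frame

/-! ### Connection and curvature components in a frame -/

section Components

variable {I : Type*} [Fintype I]

/-- The components `Γ_{am}^n` of `conn C` in the frame `E`. -/
def frameGam (C : R4 → R4 →L[ℝ] R4 →L[ℝ] R4) (E : I → R4 → R4) (a m n : I) (x : R4) : ℝ :=
  coframe E x (conn C (E a) (E m) x) n

/-- The components `W_{abm}^n` of the curvature of `conn C` in the frame `E`. -/
def frameCurv (C : R4 → R4 →L[ℝ] R4 →L[ℝ] R4) (E : I → R4 → R4) (a b m n : I) (x : R4) : ℝ :=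
  coframe E x (connCurv C (E a) (E b) (E m) x) n

variable {C : R4 → R4 →L[ℝ] R4 →L[ℝ] R4} {E : I → R4 → R4} {U : Set R4} {x : R4}

theorem sum_frameGam_smul (hE : IsFrameOn U E) (hx : x ∈ U) (a m : I) :
    conn C (E a) (E m) x = ∑ n, frameGam C E a m n x • E n x :=
  (sum_coframe_smul hE hx _).symm

theorem sum_frameCurv_smul (hE : IsFrameOn U E) (hx : x ∈ U) (a b m : I) :
    connCurv C (E a) (E b) (E m) x = ∑ n, frameCurv C E a b m n x • E n x :=
  (sum_coframe_smul hE hx _).symm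

theorem contDiffOn_frameGam (hU : IsOpen U) (hE : IsFrameOn U E)
    (hs : ∀ a, ContDiffOn ℝ ∞ (E a) U) (hC : ContDiffOn ℝ ∞ C U) (a m n : I) :
    ContDiffOn ℝ ∞ (frameGam C E a m n) U :=
  contDiffOn_pi.1 ((contDiffOn_coframe hE hs).clm_apply
    (contDiffOn_conn hU hC (hs a) (hs m))) n

theorem contDiffOn_frameCurv (hU : IsOpen U) (hE : IsFrameOn U E)
    (hs : ∀ a, ContDiffOn ℝ ∞ (E a) U) (hC : ContDiffOn ℝ ∞ C U) (a b m n : I) :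
    ContDiffOn ℝ ∞ (frameCurv C E a b m n) U :=
  contDiffOn_pi.1 ((contDiffOn_coframe hE hs).clm_apply
    (contDiffOn_connCurv hU hC (hs a) (hs b) (hs m))) n

theorem lieBracket_frame (hE : IsFrameOn U E) (hx : x ∈ U) (hC : ∀ u v, C x u v = C x v u)
    (b c : I) : VectorField.lieBracket ℝ (E b) (E c) x
      = ∑ l, (frameGam C E b c l x - frameGam C E c b l x) • E l x := by
  rw [lieBracket_eq_conn_sub_conn hC, sum_frameGam_smul hE hx, sum_frameGam_smul hE hx]
  simp only [sub_smul, Finset.sum_sub_distrib]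

/-- The components of the covariant derivative along `E_b` of a vector field with components
`φ`. -/
theorem coframe_conn (hU : IsOpen U) (hE : IsFrameOn U E) (hs : ∀ a, ContDiffOn ℝ ∞ (E a) U)
    (hx : x ∈ U) {Y : R4 → R4} {φ : I → R4 → ℝ} (hφ : ∀ l, ContDiffOn ℝ ∞ (φ l) U)
    (hY : ∀ y ∈ U, Y y = ∑ l, φ l y • E l y) (b n : I) :
    coframe E x (conn C (E b) Y x) n
      = fderiv ℝ (φ n) x (E b x) + ∑ l, φ l x * frameGam C E b l n x := by
  have e : Y =ᶠ[nhds x] fun y => ∑ l, φ l y • E l y := by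
    filter_upwards [hU.mem_nhds hx] with y hy using hY y hy
  rw [conn_congr e, conn_sum_smul (fun l => differentiableAt_of_contDiffOn (hφ l) hU hx)
    fun l => differentiableAt_of_contDiffOn (hs l) hU hx, map_add, coframe_sum_smul hE hx]
  simp [map_sum, frameGam]

theorem frameCurv_eq (hU : IsOpen U) (hE : IsFrameOn U E) (hs : ∀ a, ContDiffOn ℝ ∞ (E a) U)
    (hx : x ∈ U) (hC : ContDiffOn ℝ ∞ C U) (hsymm : ∀ u v, C x u v = C x v u) (b c m n : I) :
    frameCurv C E b c m n x
      = (fderiv ℝ (frameGam C E c m n) x (E b x)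
          + ∑ l, frameGam C E c m l x * frameGam C E b l n x
          - ∑ l, frameGam C E b c l x * frameGam C E l m n x)
        - (fderiv ℝ (frameGam C E b m n) x (E c x)
          + ∑ l, frameGam C E b m l x * frameGam C E c l n x
          - ∑ l, frameGam C E c b l x * frameGam C E l m n x) := by
  have h := contDiffOn_frameGam hU hE hs hC
  rw [frameCurv, connCurv, conn_sum_smul_left (lieBracket_frame hE hx hsymm b c)]
  simp only [map_sub, Pi.sub_apply, map_sum, map_smul, Finset.sum_apply, Pi.smul_apply,
    smul_eq_mul]
  rw [coframe_conn hU hE hs hx (h c m) (fun y hy => sum_frameGam_smul hE hy c m),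
    coframe_conn hU hE hs hx (h b m) (fun y hy => sum_frameGam_smul hE hy b m)]
  simp only [sub_mul, Finset.sum_sub_distrib, ← frameGam.eq_def]
  ring

theorem frameCurv_eq_curvTensor (hU : IsOpen U) (hs : ∀ a, ContDiffOn ℝ ∞ (E a) U)
    (hx : x ∈ U) (hC : ContDiffOn ℝ ∞ C U) (a b m n : I) :
    frameCurv C E a b m n x = coframe E x (curvTensor C x (E a x) (E b x) (E m x)) n := by
  rw [frameCurv, connCurv_eq_curvTensor hU hx hC (hs a) (hs b) (hs m)]

theorem frameCurv_antisymm (hU : IsOpen U) (hs : ∀ a, ContDiffOn ℝ ∞ (E a) U)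
    (hx : x ∈ U) (hC : ContDiffOn ℝ ∞ C U) (a b m n : I) :
    frameCurv C E b a m n x = -frameCurv C E a b m n x := by
  rw [frameCurv_eq_curvTensor hU hs hx hC, frameCurv_eq_curvTensor hU hs hx hC,
    curvTensor_antisymm, map_neg, Pi.neg_apply]

theorem frameCurv_first_bianchi (hU : IsOpen U) (hs : ∀ a, ContDiffOn ℝ ∞ (E a) U)
    (hx : x ∈ U) (hC : ContDiffOn ℝ ∞ C U) (hsymm : ∀ y ∈ U, ∀ u v, C y u v = C y v u)
    (a b c n : I) :
    frameCurv C E a b c n x + frameCurv C E b c a n x + frameCurv C E c a b n x = 0 := by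
  have h := congrArg (fun v => coframe E x v n)
    (curvTensor_first_bianchi hU hx hC hsymm (E a x) (E b x) (E c x))
  simpa only [frameCurv_eq_curvTensor hU hs hx hC, map_add, Pi.add_apply, map_zero,
    Pi.zero_apply] using h

/-- Tensoriality expands `∇_{E_b} E_m` and `[E_c, E_d]` inside the curvature; by torsion-freeness
the bracket has coefficients `Γ_{cd}^l - Γ_{dc}^l`. -/
theorem frameCurv_second_bianchi (hU : IsOpen U) (hE : IsFrameOn U E)
    (hs : ∀ a, ContDiffOn ℝ ∞ (E a) U) (hx : x ∈ U) (hC : ContDiffOn ℝ ∞ C U)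
    (hsymm : ∀ u v, C x u v = C x v u) (b c d m n : I) {F : I → I → I → ℝ}
    (hF : ∀ b c d, F b c d = fderiv ℝ (frameCurv C E c d m n) x (E b x)
      + ∑ l, frameGam C E b l n x * frameCurv C E c d m l x
      - ∑ l, frameGam C E b m l x * frameCurv C E c d l n x
      - ∑ l, (frameGam C E c d l x - frameGam C E d c l x) * frameCurv C E l b m n x) :
    F b c d + F c d b + F d b c = 0 := by
  have hFeq : ∀ b c d, F b c d = coframe E x (conn C (E b) (connCurv C (E c) (E d) (E m)) x
      - connCurv C (E c) (E d) (conn C (E b) (E m)) x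
      - connCurv C (VectorField.lieBracket ℝ (E c) (E d)) (E b) (E m) x) n := by
    intro b c d
    rw [connCurv_eq_curvTensor hU hx hC (hs c) (hs d) (contDiffOn_conn hU hC (hs b) (hs m)),
      connCurv_eq_curvTensor hU hx hC (contDiffOn_lieBracket hU (hs c) (hs d)) (hs b) (hs m),
      sum_frameGam_smul hE hx, lieBracket_frame hE hx hsymm, curvTensor_sum_smul_left,
      curvTensor_sum_smul_right, hF]
    simp only [map_sub, Pi.sub_apply, map_sum, map_smul, Finset.sum_apply, Pi.smul_apply,
      smul_eq_mul, ← frameCurv_eq_curvTensor hU hs hx hC]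
    rw [coframe_conn hU hE hs hx (contDiffOn_frameCurv hU hE hs hC c d m)
      fun y hy => sum_frameCurv_smul hE hy c d m]
    simp only [mul_comm]
  have h := congrArg (fun v => coframe E x v n)
    (connCurv_second_bianchi hU hx hC (hs b) (hs c) (hs d) (hs m))
  rw [hFeq, hFeq, hFeq]
  simpa only [map_add, Pi.add_apply, map_zero, Pi.zero_apply] using h

/-- The trace of the curvature can be computed in the frame. -/
theorem sum_coframe_curvTensor (hE : IsFrameOn U E) (hx : x ∈ U) (v w : R4) :
    ∑ n, coframe E x (curvTensor C x (E n x) v w) n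
      = ∑ μ, curvTensor C x (coordVec μ) v w μ := by
  have h1 : ∀ n, coframe E x (curvTensor C x (E n x) v w) n
      = ∑ μ, coframe E x (curvTensor C x (coordVec μ) v w) n * E n x μ := by
    intro n
    conv_lhs => rw [← sum_smul_coordVec (E n x), curvTensor_sum_smul_left]
    simp [map_sum, mul_comm]
  simp only [h1]
  rw [Finset.sum_comm]
  refine Finset.sum_congr rfl fun μ _ => ?_
  have h2 := congrFun (sum_coframe_smul hE hx (curvTensor C x (coordVec μ) v w)) μ
  simpa using h2

/-- Ricci-flatness is given for coordinate fields and extends to the frame by multilinearity.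
`ricci` traces over the first slot and `S2vac` over the second, which differ by a sign. -/
theorem frameCurv_trace_eq_zero {g : MetricField} (hU : IsOpen U) (hE : IsFrameOn U E)
    (hs : ∀ a, ContDiffOn ℝ ∞ (E a) U) (hx : x ∈ U) (hC : ContDiffOn ℝ ∞ (lcForm g) U)
    (hric : RicciFlatOn U g) (a m : I) : ∑ n, frameCurv (lcForm g) E a n m n x = 0 := by
  have h0 : ∀ μ ν, ∑ κ, curvTensor (lcForm g) x (coordVec κ) (coordVec μ) (coordVec ν) κ = 0 := by
    intro μ ν
    rw [← hric x hx μ ν, ricci, riemann_eq_connCurv]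
    exact Finset.sum_congr rfl fun κ _ => by
      rw [connCurv_eq_curvTensor hU hx hC contDiffOn_const contDiffOn_const contDiffOn_const]
  have h1 : ∑ κ, curvTensor (lcForm g) x (coordVec κ) (E a x) (E m x) κ = 0 := by
    conv_lhs => rw [← sum_smul_coordVec (E a x), ← sum_smul_coordVec (E m x)]
    simp only [curvTensor_sum_smul_middle, curvTensor_sum_smul_right, Finset.sum_apply,
      Pi.smul_apply, smul_eq_mul]
    rw [Finset.sum_comm]
    refine Finset.sum_eq_zero fun μ _ => ?_
    rw [← Finset.mul_sum, Finset.sum_comm]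
    refine mul_eq_zero_of_right _ (Finset.sum_eq_zero fun ν _ => ?_)
    rw [← Finset.mul_sum, h0, mul_zero]
  have h2 := sum_coframe_curvTensor (C := lcForm g) hE hx (E a x) (E m x)
  simp only [← frameCurv_eq_curvTensor hU hs hx hC, h1] at h2
  rw [← neg_eq_zero, ← Finset.sum_neg_distrib, ← h2]
  exact Finset.sum_congr rfl fun n _ => (frameCurv_antisymm hU hs hx hC a n m n).symm

variable [DecidableEq I] {G : Matrix I I ℝ}

theorem frameForm_frame_right (hE : IsFrameOn U E) (hx : x ∈ U) (v : R4) (n : I) :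
    frameForm G E x v (E n x) = ∑ l, coframe E x v l * G l n := by
  simp [frameForm_apply, coframe_frame hE hx, Pi.single_apply, mul_comm]

theorem frameForm_frame (hE : IsFrameOn U E) (hx : x ∈ U) (m n : I) :
    frameForm G E x (E m x) (E n x) = G m n := by
  simp [frameForm_frame_right hE hx, coframe_frame hE hx, Pi.single_apply]

theorem frameGam_compatible (hU : IsOpen U) (hE : IsFrameOn U E)
    (hs : ∀ a, ContDiffOn ℝ ∞ (E a) U) (hx : x ∈ U) (hG : G.IsSymm)
    (hc : IsCompatibleOn C (frameForm G E) U) (a m n : I) :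
    ∑ l, frameGam C E a m l x * G l n + ∑ l, frameGam C E a n l x * G l m = 0 := by
  have h := form_conn_antisymm (X := E a) hU hx (contDiffOn_frameForm hE hs) hc (hs m) (hs n)
    fun y hy => frameForm_frame hE hy m n
  rwa [frameForm_symm hG (E m x), frameForm_frame_right hE hx, frameForm_frame_right hE hx] at h

theorem frameCurv_compatible (hU : IsOpen U) (hE : IsFrameOn U E)
    (hs : ∀ a, ContDiffOn ℝ ∞ (E a) U) (hx : x ∈ U) (hC : ContDiffOn ℝ ∞ C U) (hG : G.IsSymm)
    (hc : IsCompatibleOn C (frameForm G E) U) (a b m n : I) :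
    ∑ l, frameCurv C E a b m l x * G l n + ∑ l, frameCurv C E a b n l x * G l m = 0 := by
  have h := form_connCurv_antisymm hU hx hC (contDiffOn_frameForm hE hs) hc (hs a) (hs b)
    (hs m) (hs n) fun y hy => frameForm_frame hE hy m n
  rwa [frameForm_symm hG (E m x), frameForm_frame_right hE hx, frameForm_frame_right hE hx] at h

/-- The matrix `Y * G` is antisymmetric and `H` is symmetric, so the trace of `Y = Y * G * H` equals
its own negative. -/
theorem trace_eq_zero_of_compatible (hG : G.IsSymm) {H : Matrix I I ℝ} (hH : G * H = 1)
    {Y : Matrix I I ℝ} (hY : ∀ m n, ∑ l, Y m l * G l n + ∑ l, Y n l * G l m = 0) :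
    ∑ l, Y l l = 0 := by
  have hHs : H.transpose = H := by
    have h1 : H.transpose * G = 1 := by
      rw [← hG.eq, ← Matrix.transpose_mul, hH, Matrix.transpose_one]
    rw [← Matrix.mul_one H.transpose, ← hH, ← Matrix.mul_assoc, h1, Matrix.one_mul]
  have hA : (Y * G).transpose = -(Y * G) := by
    ext m n
    rw [Matrix.transpose_apply, Matrix.neg_apply, Matrix.mul_apply, Matrix.mul_apply]
    linarith [hY m n]
  have h1 : Y.trace = (Y * G * H).trace := by rw [Matrix.mul_assoc, hH, Matrix.mul_one]
  have h2 : (Y * G * H).trace = -(Y * G * H).trace := by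
    conv_lhs => rw [← Matrix.trace_transpose, Matrix.transpose_mul, hHs, hA, Matrix.mul_neg,
      Matrix.trace_neg, Matrix.trace_mul_comm]
  have h3 : Y.trace = 0 := by linarith
  exact h3

end Components

/-! ### The section associated with a Ricci-flat metric -/

section VacuumSection

variable {I : Type*} [Fintype I]

/-- The components `((E,Γ),(0,W))` of the connection form `C` in the frame `E`. -/
def diamondOf (C : R4 → R4 →L[ℝ] R4 →L[ℝ] R4) (E : I → R4 → R4) : Diamond I := fun x =>
  ((fun A => E (A 0) x, fun A m n => frameGam C E (A 0) m n x),
    (0, fun A m n => frameCurv C E (A 0) (A 1) m n x))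

variable {C : R4 → R4 →L[ℝ] R4 →L[ℝ] R4} {E : I → R4 → R4} {U : Set R4} {x : R4}

theorem diamondOf_E (a : I) : (diamondOf C E).E a = E a := rfl

theorem diamondOf_Gam (a m n : I) : (diamondOf C E).Gam a m n = frameGam C E a m n := rfl

theorem diamondOf_W (A : Fin 2 → I) (m n : I) :
    (diamondOf C E).W A m n = frameCurv C E (A 0) (A 1) m n := rfl

theorem diamondOf_dirDeriv (b : I) (φ : R4 → ℝ) :
    (diamondOf C E).dirDeriv b φ x = fderiv ℝ φ x (E b x) := by
  conv_rhs => rw [← sum_smul_coordVec (E b x)]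
  simp [Diamond.dirDeriv, diamondOf_E, pd]

theorem contDiffOn_diamondOf (hU : IsOpen U) (hE : IsFrameOn U E)
    (hs : ∀ a, ContDiffOn ℝ ∞ (E a) U) (hC : ContDiffOn ℝ ∞ C U) :
    ContDiffOn ℝ ∞ (diamondOf C E) U := by
  refine ((contDiffOn_pi.2 fun A : Fin 1 → I => hs (A 0)).prodMk ?_).prodMk (contDiffOn_const.prodMk ?_)
  · exact contDiffOn_pi.2 fun A => contDiffOn_pi.2 fun m => contDiffOn_pi.2 fun n =>
      contDiffOn_frameGam hU hE hs hC (A 0) m n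
  · exact contDiffOn_pi.2 fun A => contDiffOn_pi.2 fun m => contDiffOn_pi.2 fun n =>
      contDiffOn_frameCurv hU hE hs hC (A 0) (A 1) m n

variable [DecidableEq I]

theorem diamondOf_T (hU : IsOpen U) (hE : IsFrameOn U E) (hs : ∀ a, ContDiffOn ℝ ∞ (E a) U)
    (hx : x ∈ U) (hsymm : ∀ u v, C x u v = C x v u) (A : Fin 2 → I) (μ : Fin 4) :
    (diamondOf C E).T A μ x = 0 := by
  have hd : ∀ b c, fderiv ℝ (fun y => E c y μ) x (E b x) = fderiv ℝ (E c) x (E b x) μ := by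
    intro b c
    rw [fderiv_apply (differentiableAt_of_contDiffOn (hs c) hU hx) μ]
    rfl
  have h := congrFun (lieBracket_frame hE hx hsymm (A 0) (A 1)) μ
  simp only [VectorField.lieBracket_eq, Pi.sub_apply, Finset.sum_apply, Pi.smul_apply,
    smul_eq_mul, sub_mul, Finset.sum_sub_distrib] at h
  simp only [Diamond.T, diamondOf_dirDeriv, diamondOf_E, diamondOf_Gam, hd]
  rw [sum_altSymbol_one_one A fun b c => fderiv ℝ (E c) x (E b x) μ
    - ∑ l, frameGam C E b c l x * E l x μ]
  linarith

theorem diamondOf_U (hU : IsOpen U) (hE : IsFrameOn U E) (hs : ∀ a, ContDiffOn ℝ ∞ (E a) U)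
    (hx : x ∈ U) (hC : ContDiffOn ℝ ∞ C U) (hsymm : ∀ u v, C x u v = C x v u)
    (A : Fin 2 → I) (m n : I) : (diamondOf C E).U A m n x = 0 := by
  simp only [Diamond.U, diamondOf_dirDeriv, diamondOf_Gam, diamondOf_W]
  rw [sum_altSymbol_one_one A fun b c => fderiv ℝ (frameGam C E c m n) x (E b x)
    + ∑ l, frameGam C E c m l x * frameGam C E b l n x
    - ∑ l, frameGam C E b c l x * frameGam C E l m n x,
    frameCurv_eq hU hE hs hx hC hsymm, sub_self]

/-- Antisymmetry of `W` in its first two indices doubles the derivative and connection terms,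
matching the coefficient 2 of the last one. The overall half then gives precisely the second Bianchi
identity. -/
theorem diamondOf_V (hU : IsOpen U) (hE : IsFrameOn U E) (hs : ∀ a, ContDiffOn ℝ ∞ (E a) U)
    (hx : x ∈ U) (hC : ContDiffOn ℝ ∞ C U) (hsymm : ∀ u v, C x u v = C x v u)
    (A : Fin 3 → I) (m n : I) : (diamondOf C E).V A m n x = 0 := by
  simp only [Diamond.V, diamondOf_dirDeriv, diamondOf_Gam, diamondOf_W, Matrix.cons_val_zero,
    Matrix.cons_val_one]
  rw [sum_altSymbol_one_two A fun b c d => fderiv ℝ (frameCurv C E c d m n) x (E b x)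
    + ∑ l, frameGam C E b l n x * frameCurv C E c d m l x
    - ∑ l, frameGam C E b m l x * frameCurv C E c d l n x
    - 2 * ∑ l, frameGam C E c d l x * frameCurv C E l b m n x]
  rw [← frameCurv_second_bianchi hU hE hs hx hC hsymm (A 0) (A 1) (A 2) m n fun _ _ _ => rfl]
  have hd : ∀ b c d, fderiv ℝ (frameCurv C E d c m n) x (E b x)
      = -fderiv ℝ (frameCurv C E c d m n) x (E b x) := by
    intro b c d
    have e : frameCurv C E d c m n =ᶠ[nhds x] fun y => -frameCurv C E c d m n y := by
      filter_upwards [hU.mem_nhds hx] with y hy using frameCurv_antisymm hU hs hy hC c d m n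
    rw [e.fderiv_eq, fderiv_fun_neg]
    rfl
  have hW : ∀ c d m n, frameCurv C E d c m n x = -frameCurv C E c d m n x :=
    frameCurv_antisymm hU hs hx hC
  rw [hd (A 0) (A 1) (A 2), hd (A 1) (A 2) (A 0), hd (A 2) (A 0) (A 1)]
  simp only [hW (A 1) (A 2), hW (A 2) (A 0), hW (A 0) (A 1), mul_neg, Finset.sum_neg_distrib,
    sub_mul, Finset.sum_sub_distrib]
  ring

variable {G : Matrix I I ℝ}

theorem diamondOf_fst_mem (hU : IsOpen U) (hE : IsFrameOn U E)
    (hs : ∀ a, ContDiffOn ℝ ∞ (E a) U) (hx : x ∈ U) (hG : G.IsSymm) {H : Matrix I I ℝ}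
    (hH : G * H = 1) (hc : IsCompatibleOn C (frameForm G E) U) :
    (diamondOf C E x).1 ∈ S G 1 := by
  refine ⟨fun π A μ => ?_, fun π A m n => ?_, fun A m n => ?_⟩
  · simp [Subsingleton.elim π 1]
  · simp [Subsingleton.elim π 1]
  · have h := frameGam_compatible hU hE hs hx hG hc (A 0)
    have ht := trace_eq_zero_of_compatible hG hH (Y := fun m n => frameGam C E (A 0) m n x) h
    change ∑ l, frameGam C E (A 0) m l x * G l n + ∑ l, frameGam C E (A 0) n l x * G l m
      = (1 / 2) * (∑ l, frameGam C E (A 0) l l x) * G m n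
    rw [h, ht]
    ring

theorem diamondOf_snd_mem {g : MetricField} (hU : IsOpen U) (hE : IsFrameOn U E)
    (hs : ∀ a, ContDiffOn ℝ ∞ (E a) U) (hx : x ∈ U) (hC : ContDiffOn ℝ ∞ (lcForm g) U)
    (hsymm : ∀ y ∈ U, ∀ u v, lcForm g y u v = lcForm g y v u) (hG : G.IsSymm)
    {H : Matrix I I ℝ} (hH : G * H = 1) (hc : IsCompatibleOn (lcForm g) (frameForm G E) U)
    (hric : RicciFlatOn U g) : (diamondOf (lcForm g) E x).2 ∈ S2vac G := by
  have h := frameCurv_compatible hU hE hs hx hC hG hc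
  have hW := frameCurv_antisymm hU hs hx hC
  refine ⟨⟨fun π A μ => ?_, fun π A m n => ?_, fun A m n => ?_⟩, rfl, fun A n => ?_,
    fun A m n => h (A 0) (A 1) m n, fun a m => frameCurv_trace_eq_zero hU hE hs hx hC hric a m⟩
  · exact (mul_zero _).symm
  · exact antisymm_fin_two (f := fun A : Fin 2 → I => frameCurv (lcForm g) E (A 0) (A 1) m n x)
      (fun A => hW (A 0) (A 1) m n) π A
  · have ht := trace_eq_zero_of_compatible hG hH
      (Y := fun m n => frameCurv (lcForm g) E (A 0) (A 1) m n x) (h (A 0) (A 1))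
    change ∑ l, frameCurv (lcForm g) E (A 0) (A 1) m l x * G l n
        + ∑ l, frameCurv (lcForm g) E (A 0) (A 1) n l x * G l m
      = (1 / 2) * (∑ l, frameCurv (lcForm g) E (A 0) (A 1) l l x) * G m n
    rw [h, ht]
    ring
  · exact sum_altSymbol_three A (fun b c d => frameCurv (lcForm g) E b c d n x)
      (fun b c d => hW c b d n) fun b c d =>
        frameCurv_first_bianchi hU hs hx hC hsymm b c d n

end VacuumSection

end VacuumFormalism

end

/-! ### Existence of the vacuum section -/

theorem mainTheorem9 {I : Type*} [Fintype I] [DecidableEq I] (hI : Fintype.card I = 4)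
    (G : Matrix I I ℝ) (hG : VacuumFormalism.HasLorentzSignature G)
    (U : Set VacuumFormalism.R4) (hUo : IsOpen U) (hUc : IsSimplyConnected U)
    (E : I → VacuumFormalism.R4 → VacuumFormalism.R4)
    (hEs : ∀ a, ContDiffOn ℝ (⊤ : ℕ∞) (E a) U) (hEf : VacuumFormalism.IsFrameOn U E)
    (g : VacuumFormalism.MetricField)
    (hg : ∀ x ∈ U, ∀ a b, g x (E a x) (E b x) = G a b)
    (hric : VacuumFormalism.RicciFlatOn U g) :
    ∃ d : VacuumFormalism.Diamond I,
      (∀ x ∈ U, ∀ a, d.E a x = E a x) ∧ VacuumFormalism.ArisesFrom U G d g := by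
  open VacuumFormalism in
  obtain ⟨H, hH⟩ := hG.exists_inverse hI
  have hh := contDiffOn_frameForm (G := G) hEf hEs
  have hgh : ∀ y ∈ U, ∀ u v, g y u v = frameForm G E y u v := fun y hy =>
    eq_frameForm hEf hy (hg y hy)
  have hs : ∀ y ∈ U, ∀ u v, frameForm G E y u v = frameForm G E y v u := fun _ _ =>
    frameForm_symm hG.1
  have hmul := fun y (hy : y ∈ U) => metricMatrix_mul hEf hy (hg y hy) hH
  have hinv : ∀ μ ν, ContDiffOn ℝ (⊤ : ℕ∞) (fun y => (metricMatrix g y)⁻¹ μ ν) U := by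
    intro μ ν
    have h : ContDiffOn ℝ (⊤ : ℕ∞)
        (fun y => ∑ a, ∑ b, H a b * (E a y μ * E b y ν)) U :=
      ContDiffOn.sum fun a _ => ContDiffOn.sum fun b _ => contDiffOn_const.mul
        ((contDiffOn_pi.1 (hEs a) μ).mul (contDiffOn_pi.1 (hEs b) ν))
    refine h.congr fun y hy => ?_
    rw [Matrix.inv_eq_right_inv (hmul y hy), Matrix.of_apply]
  have hi : ∀ y ∈ U, metricMatrix g y * (metricMatrix g y)⁻¹ = 1 := fun y hy => by
    rw [Matrix.inv_eq_right_inv (hmul y hy), hmul y hy]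
  have hC := contDiffOn_lcForm hUo hh hgh hinv
  have hsymm : ∀ y ∈ U, ∀ u v, lcForm g y u v = lcForm g y v u := fun y hy =>
    lcForm_symm hUo hy hh hgh hs
  have hc := isCompatibleOn_lcForm hUo hh hgh hs hi
  refine ⟨diamondOf (lcForm g) E, fun _ _ _ => rfl, ?_⟩
  constructor
  · exact ⟨contDiffOn_diamondOf hUo hEf hEs hC, fun x hx =>
      ⟨diamondOf_fst_mem hUo hEf hEs hx hG.1 hH hc,
        diamondOf_snd_mem hUo hEf hEs hx hC hsymm hG.1 hH hc hric⟩⟩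
  · intro x hx
    refine Prod.ext (Prod.ext ?_ ?_) (Prod.ext rfl ?_)
    · funext A μ
      exact diamondOf_T hUo hEf hEs hx (hsymm x hx) A μ
    · funext A m n
      exact diamondOf_U hUo hEf hEs hx hC (hsymm x hx) A m n
    · funext A m n
      exact diamondOf_V hUo hEf hEs hx hC (hsymm x hx) A m n
  · exact hEf
  -- The frame values of `g` are already `G a b`, so `e^f = 1`; correspondingly `ν = 0`, since `Γ`
  -- is trace-free.
  · refine ⟨fun _ => 0, contDiffOn_const, fun x hx a => ?_, fun x hx a b => ?_⟩
    · have ht := trace_eq_zero_of_compatible hG.1 hH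
        (Y := fun m n => frameGam (lcForm g) E a m n x)
        (frameGam_compatible hUo hEf hEs hx hG.1 hc a)
      simp only [diamondOf_Gam, ht]
      simp
    · rw [Real.exp_zero, one_mul]
      exact hg x hx a b
  · intro x hx a m
    rw [leviCivita_eq_conn]
    exact sum_frameGam_smul hEf hx a m
  · intro x hx a b m
    rw [riemann_eq_connCurv]
    exact sum_frameCurv_smul hEf hx a b m
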